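/- All spaces are $T_1$ and have no isolated points. Let $X$ be such a space. For $A\subseteq X$ let $\mathrm{cl}_\theta(A)=\{x\in X:\overline U\cap A\neq\emptyset\text{ for every neighbourhood }U\text{ of }x\}$. A set $D\subseteq X$ is $\theta$-dense if $\mathrm{cl}_\theta(D)=X$; $\mathcal D_\theta$ is the family of $\theta$-dense subsets of $X$. A countable $\theta$-dense set $C$ is groupably $\theta$-dense if $C=\bigcup_{n<\omega}C_n$ with pairwise disjoint finite sets $C_n$ such that for each nonempty open $U$, $\overline U\cap C_n\neq\emptyset$ for all but finitely many $n$; $\mathcal D_\theta^{gp}$ is the family of these sets. Put $\delta_\theta(X)=\min\{\lambda\ge\aleph_0:\text{each }\theta\text{-dense }D\subseteq X\text{ contains a }\theta\text{-dense }C\subseteq D\text{ with }|C|\le\lambda\}$, and let $\pi_\theta(X)$ be the least cardinality of a family $\mathcal V$ of nonempty open sets such that for each nonempty open $U$ there is a $V\in\mathcal V$ with $V\subseteq\overline U$. $\mathsf S_{fin}(\mathcal A,\mathcal B)$ says: for each sequence $(A_n)_{n<\omega}$ in $\mathcal A$ there are finite $B_n\subseteq A_n$ with $\bigcup_{n}B_n\in\mathcal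 B$. In the game $\mathsf G_{fin}(\mathcal A,\mathcal B)$, in each inning $n<\omega$ player ONE chooses $O_n\in\mathcal A$ and TWO answers with a finite $T_n\subseteq O_n$; TWO wins if $\bigcup_n T_n\in\mathcal B$, otherwise ONE wins. Let $\mathfrak b$ be the least cardinality of a subset of ${}^\omega\omega$ that is unbounded with respect to eventual domination. **Theorem.** For an infinite cardinal $\kappa$ the following are equivalent: 1. $\kappa<\mathfrak b$. 2. For each space $X$ in which $\overline U\cap D$ is infinite for each $\theta$-dense $D$ and each nonempty open $U$, and with $\delta_\theta(X)=\aleph_0$ and $\pi_\theta(X)\le\kappa$, ONE has no winning strategy in $\mathsf G_{fin}(\mathcal D_\theta,\mathcal D_\theta^{gp})$. 3. For each space $X$ in which $\overline U\cap D$ is infinite for each $\theta$-dense $D$ and each nonempty open $U$, and with $\delta_\theta(X)=\aleph_0$ and $\pi_\theta(X)\le\kappa$, the selection principle $\mathsf S_{fin}(\mathcal D_\theta,\mathcal D_\theta^{gp})$ holds. -/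

import Mathlib

open Set Filter Topology Cardinal

universe u

namespace ThetaSelection

/-- The bounding number `𝔟`: the least cardinality of a family of functions `ℕ → ℕ`
that is unbounded in the order of eventual domination. -/
noncomputable def boundingNumber : Cardinal.{0} :=
  sInf {c | ∃ F : Set (ℕ → ℕ), (¬ ∃ g : ℕ → ℕ, ∀ f ∈ F, ∀ᶠ n in atTop, f n ≤ g n) ∧ #F = c}

section Selection

variable {X : Type u}

/-- The selection principle `S_fin(𝒜, ℬ)`. -/
def SFin (𝒜 ℬ : Set (Set X)) : Prop :=
  ∀ A : ℕ → Set X, (∀ n, A n ∈ 𝒜) →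
    ∃ B : ℕ → Finset X, (∀ n, (B n : Set X) ⊆ A n) ∧ (⋃ n, (B n : Set X)) ∈ ℬ

/-- `σ` is a winning strategy for ONE in the game `G_fin(𝒜, ℬ)`. In inning `n` the strategy sees
the list of TWO's moves `T 0, …, T (n - 1)` and answers with an element of `𝒜`; TWO then chooses a
finite subset `T n` of it. ONE wins the play when the union of TWO's moves is not in `ℬ`. -/
def IsWinningForOneGFin (𝒜 ℬ : Set (Set X)) (σ : List (Finset X) → Set X) : Prop :=
  (∀ s, σ s ∈ 𝒜) ∧
    ∀ T : ℕ → Finset X, (∀ n, (T n : Set X) ⊆ σ ((List.range n).map T)) →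
      (⋃ n, (T n : Set X)) ∉ ℬ

/-- ONE has a winning strategy in the game `G_fin(𝒜, ℬ)`. -/
def OneWinsGFin (𝒜 ℬ : Set (Set X)) : Prop :=
  ∃ σ : List (Finset X) → Set X, IsWinningForOneGFin 𝒜 ℬ σ

end Selection

section Theta

variable {X : Type u} [TopologicalSpace X]

/-- The `θ`-closure of a set. -/
def thetaClosure (A : Set X) : Set X :=
  {x | ∀ U ∈ 𝓝 x, (closure U ∩ A).Nonempty}

/-- A set is `θ`-dense if its `θ`-closure is the whole space. -/
def IsThetaDense (D : Set X) : Prop :=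
  thetaClosure D = Set.univ

/-- A countable `θ`-dense set is groupably `θ`-dense if it splits into pairwise disjoint finite
sets `P n` such that the closure of each nonempty open set meets all but finitely many of them.
(In a nonempty space at most finitely many `P n` can be empty.) -/
def IsGroupablyThetaDense (C : Set X) : Prop :=
  C.Countable ∧ IsThetaDense C ∧
    ∃ P : ℕ → Set X, (∀ n, (P n).Finite) ∧ Pairwise (fun m n => Disjoint (P m) (P n)) ∧
      (⋃ n, P n) = C ∧
      ∀ U : Set X, IsOpen U → U.Nonempty → ∀ᶠ n in atTop, (closure U ∩ P n).Nonempty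

variable (X)

/-- The family `𝒟_θ` of `θ`-dense subsets of `X`. -/
def thetaDenseSets : Set (Set X) :=
  {D | IsThetaDense D}

/-- The family `𝒟_θ^gp` of groupably `θ`-dense subsets of `X`. -/
def groupablyThetaDenseSets : Set (Set X) :=
  {D | IsGroupablyThetaDense D}

variable {X}

/-- A `θ`-`π`-base: a family of nonempty open sets such that the closure of each nonempty open
set contains a member of the family. -/
def IsThetaPiBase (𝒱 : Set (Set X)) : Prop :=
  (∀ V ∈ 𝒱, IsOpen V ∧ V.Nonempty) ∧
    ∀ U : Set X, IsOpen U → U.Nonempty → ∃ V ∈ 𝒱, V ⊆ closure U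

variable (X)

/-- The cardinal function `π_θ`: the least cardinality of a `θ`-`π`-base. -/
noncomputable def piTheta : Cardinal.{u} :=
  sInf {c | ∃ 𝒱 : Set (Set X), IsThetaPiBase 𝒱 ∧ #𝒱 = c}

/-- The cardinal function `δ_θ`: the least infinite cardinal `c` such that each `θ`-dense set
contains a `θ`-dense set of cardinality at most `c`. -/
noncomputable def deltaTheta : Cardinal.{u} :=
  sInf {c | ℵ₀ ≤ c ∧ ∀ D : Set X, IsThetaDense D → ∃ C ⊆ D, IsThetaDense C ∧ #C ≤ c}

/-- Each `θ`-dense set has infinite intersection with the closure of each nonempty open set.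
This is necessary for `S_fin(𝒟_θ, 𝒟_θ^gp)`; it fails, for instance, for the cofinite topology on an
infinite set, where each singleton is `θ`-dense. -/
def ThetaDenseSetsMeetInfinitely : Prop :=
  ∀ D : Set X, IsThetaDense D → ∀ U : Set X, IsOpen U → U.Nonempty → (closure U ∩ D).Infinite

end Theta

end ThetaSelection

/-! If `κ < 𝔟`, fix a strategy of ONE and exhaust a countable θ-dense part of each of its moves by
finite stages. TWO only picks stages, so positions form a countable tree. Each member of a θ-π-base
defines a function on the tree: the stage from which new points meet its closure. One `g` dominates
all these functions modulo finite, and TWO follows `g`; the new points of each inning form the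
groups.

If `𝔟 ≤ κ`, take an unbounded family of monotone `f` as coordinates of a Cantor cube, and a
countable dense subspace with dense rows, where the `m`-th point of row `n` can vanish at `f` only
if `f n ≤ m`. Groups of a finite selection lie in ever later rows; some `f` exceeds their column
bounds infinitely often, so infinitely many groups miss the clopen set of points vanishing at `f`.
-/

namespace ThetaSelection

/-! ### Families of functions and the bounding number -/

section Bounding

/-- Families of functions on a countable type of size less than `𝔟` are bounded modulo finite. -/
lemma exists_eventually_cofinite_bound {ι : Type u} {S : Type} [Denumerable S]
    (hι : #ι < Cardinal.lift.{u, 0} boundingNumber) (f : ι → S → ℕ) :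
    ∃ g : S → ℕ, ∀ i, ∀ᶠ s in cofinite, f i s ≤ g s := by
  let e : S ≃ ℕ := Denumerable.eqv S
  let F : Set (ℕ → ℕ) := range fun i => f i ∘ e.symm
  have hF : #F < boundingNumber := by
    have h : Cardinal.lift.{u} #F ≤ Cardinal.lift.{0} #ι :=
      mk_range_le_lift
    rw [← Cardinal.lift_lt.{0, u}]
    exact h.trans_lt (by simpa using hι)
  have hb : ∃ g : ℕ → ℕ, ∀ f ∈ F, ∀ᶠ n in atTop, f n ≤ g n := by
    by_contra hcon
    exact hF.not_ge (csInf_le' ⟨F, hcon, rfl⟩)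
  obtain ⟨g, hg⟩ := hb
  refine ⟨g ∘ e, fun i => ?_⟩
  have h := hg _ ⟨i, rfl⟩
  rw [← Nat.cofinite_eq_atTop] at h
  have h' := e.injective.tendsto_cofinite.eventually h
  simpa using h'

/-- There is an unbounded family of monotone functions of size at most `𝔟`. -/
lemma exists_unbounded_monotone_family :
    ∃ F : Set (ℕ → ℕ), (∀ f ∈ F, Monotone f) ∧ #F ≤ boundingNumber ∧
      ∀ g : ℕ → ℕ, ∃ f ∈ F, ∃ᶠ n in atTop, g n < f n := by
  have hne : {c | ∃ F : Set (ℕ → ℕ),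
      (¬ ∃ g : ℕ → ℕ, ∀ f ∈ F, ∀ᶠ n in atTop, f n ≤ g n) ∧ #F = c}.Nonempty := by
    refine ⟨_, univ, ?_, rfl⟩
    rintro ⟨g, hg⟩
    obtain ⟨n, hn⟩ := (hg (fun n => g n + 1) (mem_univ _)).exists
    omega
  obtain ⟨F, hF, hc⟩ := csInf_mem hne
  -- Running maxima are monotone and lie above the original functions, so unboundedness survives.
  refine ⟨(fun f => partialSups f) '' F, ?_, ?_, fun g => ?_⟩
  · rintro _ ⟨f, -, rfl⟩
    exact (partialSups f).monotone
  · exact mk_image_le.trans hc.le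
  · by_contra! hcon
    refine hF ⟨g, fun f hf => ?_⟩
    have h := hcon _ ⟨f, hf, rfl⟩
    filter_upwards [h] with n hn
    exact (le_partialSups f n).trans hn

lemma infinite_of_unbounded {F : Set (ℕ → ℕ)}
    (hF : ∀ g : ℕ → ℕ, ∃ f ∈ F, ∃ᶠ n in atTop, g n < f n) : F.Infinite := by
  intro hfin
  obtain ⟨f, hf, h⟩ := hF fun n => hfin.toFinset.sup fun f => f n
  obtain ⟨n, hn⟩ := h.exists
  exact hn.not_ge (Finset.le_sup (f := fun f : ℕ → ℕ => f n) (hfin.mem_toFinset.2 hf))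

end Bounding

/-! ### θ-density and its cardinal functions -/

section Theta

variable {X : Type u} [TopologicalSpace X]

lemma exists_thetaPiBase_of_piTheta_le {κ : Cardinal.{u}} (h : piTheta X ≤ κ) :
    ∃ 𝒱 : Set (Set X), IsThetaPiBase 𝒱 ∧ #𝒱 ≤ κ := by
  have hne : {c | ∃ 𝒱 : Set (Set X), IsThetaPiBase 𝒱 ∧ #𝒱 = c}.Nonempty :=
    ⟨_, {V | IsOpen V ∧ V.Nonempty}, ⟨fun _ hV => hV, fun U hU hne => ⟨U, ⟨hU, hne⟩,
      subset_closure⟩⟩, rfl⟩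
  obtain ⟨𝒱, h𝒱, hc⟩ := csInf_mem hne
  exact ⟨𝒱, h𝒱, hc.trans_le h⟩

lemma exists_countable_thetaDense_subset (h : deltaTheta X = ℵ₀) {D : Set X}
    (hD : IsThetaDense D) : ∃ C ⊆ D, IsThetaDense C ∧ C.Countable := by
  have hne : {c : Cardinal.{u} | ℵ₀ ≤ c ∧
      ∀ D : Set X, IsThetaDense D → ∃ C ⊆ D, IsThetaDense C ∧ #C ≤ c}.Nonempty := by
    -- The infimum of an empty set of cardinals is 0, which differs from `ℵ₀`.
    by_contra hcon
    rw [not_nonempty_iff_eq_empty] at hcon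
    rw [deltaTheta, hcon, Cardinal.sInf_empty] at h
    exact aleph0_ne_zero h.symm
  have hmem := csInf_mem hne
  rw [← deltaTheta, h] at hmem
  obtain ⟨C, hC, hd, hc⟩ := hmem.2 D hD
  exact ⟨C, hC, hd, le_aleph0_iff_set_countable.1 hc⟩

lemma isThetaDense_of_closure_inter_nonempty {C : Set X}
    (h : ∀ U : Set X, IsOpen U → U.Nonempty → (closure U ∩ C).Nonempty) : IsThetaDense C := by
  refine eq_univ_of_forall fun x U hU => ?_
  exact (h _ isOpen_interior ⟨x, mem_interior_iff_mem_nhds.2 hU⟩).mono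
    (inter_subset_inter_left _ (closure_mono interior_subset))

lemma isThetaDense_iff_dense [RegularSpace X] {D : Set X} : IsThetaDense D ↔ Dense D := by
  constructor
  · intro h x
    rw [mem_closure_iff_nhds]
    intro t ht
    obtain ⟨s, hs, hsc, hst⟩ := exists_mem_nhds_isClosed_subset ht
    have hx : x ∈ thetaClosure D := h ▸ mem_univ x
    have := hx s hs
    rw [hsc.closure_eq] at this
    exact this.mono (inter_subset_inter_left _ hst)
  · intro h
    refine isThetaDense_of_closure_inter_nonempty fun U hU hne => ?_
    exact (h.inter_open_nonempty U hU hne).mono (inter_subset_inter_left _ subset_closure)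

/-- The points new in each inning serve as the groups: they are pairwise disjoint and have the same
union. -/
lemma isGroupablyThetaDense_iUnion_finset [DecidableEq X] (T : ℕ → Finset X)
    (h : ∀ U : Set X, IsOpen U → U.Nonempty →
      ∀ᶠ n in atTop, (closure U ∩ ((disjointed T n : Finset X) : Set X)).Nonempty) :
    IsGroupablyThetaDense (⋃ n, (T n : Set X)) := by
  have hun : (⋃ n, ((disjointed T n : Finset X) : Set X)) = ⋃ n, (T n : Set X) := by
    apply subset_antisymm
    · exact iUnion_mono fun n => Finset.coe_subset.2 (disjointed_le T n)
    · intro x hx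
      have hx' : ∃ n, x ∈ T n := by simpa using hx
      refine mem_iUnion.2 ⟨Nat.find hx', ?_⟩
      rw [disjointed_apply, Finset.mem_coe, Finset.mem_sdiff]
      refine ⟨Nat.find_spec hx', fun hmem => ?_⟩
      obtain ⟨i, hi, hxi⟩ := Finset.mem_sup.1 hmem
      exact Nat.find_min hx' (Finset.mem_Iio.1 hi) hxi
  refine ⟨countable_iUnion fun n => (T n).countable_toSet, ?_, fun n => ((disjointed T n : Finset X) : Set X),
    fun n => Finset.finite_toSet _, fun m n hmn => ?_, hun, h⟩
  · refine isThetaDense_of_closure_inter_nonempty fun U hU hne => ?_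
    obtain ⟨n, hn⟩ := (h U hU hne).exists
    refine hn.mono (inter_subset_inter_right _ ?_)
    rw [← hun]
    exact subset_iUnion (fun n => ((disjointed T n : Finset X) : Set X)) n
  · exact Finset.disjoint_coe.2 (disjoint_disjointed T hmn)

end Theta

/-! ### From the bounding number to the game -/

lemma sFin_of_not_oneWinsGFin {X : Type u} {𝒜 ℬ : Set (Set X)} (h : ¬ OneWinsGFin 𝒜 ℬ) :
    SFin 𝒜 ℬ := by
  intro A hA
  by_contra hcon
  -- ONE ignores TWO's moves and only counts innings.
  refine h ⟨fun s => A s.length, fun s => hA _, fun T hT hB => hcon ⟨T, fun n => ?_, hB⟩⟩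
  simpa using hT n

lemma exists_monotone_finset_exhaustion {X : Type u} {C : Set X} (hC : C.Countable) :
    ∃ E : ℕ → Finset X, Monotone E ∧ ⋃ n, (E n : Set X) = C := by
  classical
  have := hC.to_subtype
  obtain ⟨f, hf⟩ := Countable.exists_injective_nat C
  have hfin (n : ℕ) : (Subtype.val '' (f ⁻¹' Iic n)).Finite :=
    ((finite_Iic n).preimage hf.injOn).image _
  refine ⟨fun n => (hfin n).toFinset, fun m n hmn => ?_, ?_⟩
  · rw [Finite.toFinset_subset_toFinset]
    exact image_mono (preimage_mono (Iic_subset_Iic.2 hmn))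
  · ext x
    simp only [Finite.coe_toFinset, mem_iUnion]
    constructor
    · rintro ⟨n, y, -, rfl⟩
      exact y.2
    · intro hx
      exact ⟨f ⟨x, hx⟩, ⟨x, hx⟩, mem_preimage.2 self_mem_Iic, rfl⟩

theorem not_oneWinsGFin_of_lt_boundingNumber {κ : Cardinal.{u}}
    (hκ : κ < Cardinal.lift.{u, 0} boundingNumber) (X : Type u) [TopologicalSpace X]
    (hinf : ThetaDenseSetsMeetInfinitely X) (hδ : deltaTheta X = ℵ₀) (hπ : piTheta X ≤ κ) :
    ¬ OneWinsGFin (thetaDenseSets X) (groupablyThetaDenseSets X) := by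
  classical
  rintro ⟨σ, hσ, hwin⟩
  obtain ⟨𝒱, h𝒱, hcard⟩ := exists_thetaPiBase_of_piTheta_le hπ
  have hE (s : List (Finset X)) : ∃ E : ℕ → Finset X, Monotone E ∧ (∀ n, (E n : Set X) ⊆ σ s) ∧
      IsThetaDense (⋃ n, (E n : Set X)) := by
    obtain ⟨C, hCs, hCd, hCc⟩ := exists_countable_thetaDense_subset hδ (hσ s)
    obtain ⟨E, hm, hu⟩ := exists_monotone_finset_exhaustion hCc
    exact ⟨E, hm, fun n => (subset_iUnion (fun n => (E n : Set X)) n).trans (hu.trans_subset hCs),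
      hu ▸ hCd⟩
  choose E hEm hEs hEd using hE
  -- `play s` is the list of TWO's moves when TWO chooses stages of the exhaustions along `s`;
  -- lists of natural numbers are read with the latest choice first.
  let play : List ℕ → List (Finset X) := fun s => s.rec [] fun n _ p => p ++ [E p n]
  let old : List ℕ → Finset X := fun s => (play s).toFinset.sup id
  -- Only finitely many points were played before, so the infinite intersection supplies a new one;
  -- it stays in all later stages.
  have hf (V : 𝒱) (s : List ℕ) :
      ∃ m, ∀ n ≥ m, (closure V.1 ∩ (E (play s) n \ old s : Finset X)).Nonempty := by
    have hV := h𝒱.1 V.1 V.2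
    obtain ⟨x, ⟨hxV, hxE⟩, hx⟩ := (hinf _ (hEd (play s)) V.1 hV.1 hV.2).exists_notMem_finset (old s)
    obtain ⟨m, hm⟩ := mem_iUnion.1 hxE
    refine ⟨m, fun n hn => ⟨x, hxV, ?_⟩⟩
    exact Finset.mem_coe.2 (Finset.mem_sdiff.2 ⟨hEm _ hn hm, hx⟩)
  choose f hf using hf
  obtain ⟨g, hg⟩ := exists_eventually_cofinite_bound (hcard.trans_lt hκ) f
  let branch : ℕ → List ℕ := fun n => n.rec [] fun _ s => g s :: s
  have hlen (n : ℕ) : (branch n).length = n := by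
    induction n with
    | zero => rfl
    | succ n ih => simpa [branch] using ih
  -- Injectivity turns "all but finitely many nodes" into "all but finitely many innings".
  have hbinj : Function.Injective branch := fun m n h => by rw [← hlen m, ← hlen n, h]
  let T : ℕ → Finset X := fun n => E (play (branch n)) (g (branch n))
  have hplay (n : ℕ) : play (branch n) = (List.range n).map T := by
    induction n with
    | zero => rfl
    | succ n ih =>
      rw [List.range_succ, List.map_append, ← ih]
      rfl
  refine hwin T (fun n => ?_) (isGroupablyThetaDense_iUnion_finset T fun U hU hne => ?_)
  · rw [← hplay]
    exact hEs _ _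
  obtain ⟨V, hV, hVU⟩ := h𝒱.2 U hU hne
  have hev := hbinj.tendsto_cofinite.eventually (hg ⟨V, hV⟩)
  rw [Nat.cofinite_eq_atTop] at hev
  filter_upwards [hev] with n hn
  refine (hf ⟨V, hV⟩ (branch n) _ hn).mono (inter_subset_inter
    (closure_minimal hVU isClosed_closure) ?_)
  rw [Finset.coe_subset, disjointed_apply]
  refine Finset.sdiff_subset_sdiff subset_rfl (Finset.sup_le fun i hi => ?_)
  refine Finset.le_sup (f := id) (b := T i) ?_
  rw [hplay, List.mem_toFinset]
  exact List.mem_map_of_mem (List.mem_range.2 (Finset.mem_Iio.1 hi))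

/-! ### Countable dense subspaces of Cantor cubes -/

section Example

/-- There is a countable set of points of `2 ^ (ℕ → ℕ)` that is dense, with infinite repetition. -/
lemma exists_frequently_dense_seq : ∃ z : ℕ → (ℕ → ℕ) → Bool,
    ∀ (J : Finset (ℕ → ℕ)) (ε : (ℕ → ℕ) → Bool) (M : ℕ), ∃ m ≥ M, ∀ f ∈ J, z m f = ε f := by
  classical
  obtain ⟨s, hs⟩ := exists_surjective_nat (ℕ × Finset (List ℕ))
  -- The second component of `m` codes a length and a finite set of lists; the value tests whether
  -- that initial segment of `f` is in the set. The free first component makes `m` arbitrarily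
  -- large.
  refine ⟨fun m f => decide ((List.range (s m.unpair.2).1).map f ∈ (s m.unpair.2).2),
    fun J ε M => ?_⟩
  have hsep (f g : ℕ → ℕ) : ∃ n, f n = g n → f = g := by
    by_contra! h
    exact (h 0).2 (funext fun n => (h n).1)
  choose d hd using hsep
  -- Initial segments of this length separate the members of `J`.
  let N := (J ×ˢ J).sup fun p => d p.1 p.2 + 1
  have hN {f g : ℕ → ℕ} (hf : f ∈ J) (hg : g ∈ J)
      (h : (List.range N).map f = (List.range N).map g) : f = g := by
    refine hd f g (List.map_inj_left.1 h _ (List.mem_range.2 ?_))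
    exact Finset.le_sup (f := fun p : (ℕ → ℕ) × (ℕ → ℕ) => d p.1 p.2 + 1)
      (Finset.mk_mem_product hf hg)
  obtain ⟨c, hc⟩ := hs (N, {f ∈ J | ε f = true}.image fun f => (List.range N).map f)
  refine ⟨Nat.pair M c, Nat.left_le_pair _ _, fun f hf => ?_⟩
  beta_reduce
  rw [Nat.unpair_pair, hc, Bool.eq_iff_iff, decide_eq_true_iff, Finset.mem_image]
  constructor
  · rintro ⟨g, hg, hgf⟩
    rw [Finset.mem_filter] at hg
    exact hN hg.1 hf hgf ▸ hg.2
  · intro h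
    exact ⟨f, Finset.mem_filter.2 ⟨hf, h⟩, rfl⟩

/-- The set `D ⊆ 2 ^ I` realizes each finite pattern. -/
def RealizesPatterns {I : Type u} (D : Set (I → Bool)) : Prop :=
  ∀ (J : Finset I) (ε : I → Bool), ∃ y ∈ D, ∀ i ∈ J, y i = ε i

lemma exists_cylinder_subset {I : Type u} {U : Set (I → Bool)} (hU : IsOpen U) {x : I → Bool}
    (hx : x ∈ U) : ∃ J : Finset I, ∀ y : I → Bool, (∀ i ∈ J, y i = x i) → y ∈ U := by
  obtain ⟨J, u, hu, hJ⟩ := isOpen_pi_iff.1 hU x hx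
  refine ⟨J, fun y hy => hJ fun i hi => ?_⟩
  rw [hy i hi]
  exact (hu i hi).2

lemma isOpen_cylinder {I : Type u} (J : Finset I) (ε : I → Bool) :
    IsOpen {y : I → Bool | ∀ i ∈ J, y i = ε i} := by
  have : {y : I → Bool | ∀ i ∈ J, y i = ε i} = (J : Set I).pi fun i => {ε i} := by
    ext y
    simp [Set.mem_pi]
  rw [this]
  exact isOpen_set_pi J.finite_toSet fun i _ => isOpen_discrete _

lemma RealizesPatterns.not_isOpen_singleton {I : Type u} [Infinite I] {D : Set (I → Bool)}
    (hD : RealizesPatterns D) (x : D) : ¬ IsOpen ({x} : Set D) := by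
  classical
  intro h
  obtain ⟨U, hU, hUx⟩ := isOpen_induced_iff.1 h
  have hxU : x.1 ∈ U := by
    have : x ∈ Subtype.val ⁻¹' U := hUx ▸ mem_singleton x
    exact this
  obtain ⟨J, hJ⟩ := exists_cylinder_subset hU hxU
  obtain ⟨i, hi⟩ := Infinite.exists_notMem_finset J
  -- Flipping a coordinate outside `J` gives a second point of the neighbourhood.
  obtain ⟨y, hy, hyJ⟩ := hD (insert i J) (Function.update x.1 i (!x.1 i))
  have hyU : y ∈ U := hJ y fun j hj => by
    rw [hyJ j (Finset.mem_insert_of_mem hj), Function.update_of_ne (ne_of_mem_of_not_mem hj hi)]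
  have hyx : (⟨y, hy⟩ : D) = x := by
    have : (⟨y, hy⟩ : D) ∈ Subtype.val ⁻¹' U := hyU
    rwa [hUx] at this
  have hi' := hyJ i (Finset.mem_insert_self _ _)
  rw [Function.update_self, ← hyx] at hi'
  simp at hi'

lemma RealizesPatterns.piTheta_le {I : Type u} [Infinite I] {D : Set (I → Bool)}
    (hD : RealizesPatterns D) : piTheta D ≤ #I := by
  classical
  let V : Finset I × Finset I → Set D := fun p => {y | ∀ i ∈ p.1, y.1 i = decide (i ∈ p.2)}
  have hV : IsThetaPiBase (range V) := by
    constructor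
    · rintro _ ⟨p, rfl⟩
      refine ⟨(isOpen_cylinder p.1 fun i => decide (i ∈ p.2)).preimage continuous_subtype_val, ?_⟩
      obtain ⟨y, hy, hyJ⟩ := hD p.1 fun i => decide (i ∈ p.2)
      exact ⟨⟨y, hy⟩, hyJ⟩
    · rintro _ hW ⟨x, hx⟩
      obtain ⟨U, hU, rfl⟩ := isOpen_induced_iff.1 hW
      obtain ⟨J, hJ⟩ := exists_cylinder_subset hU hx
      refine ⟨_, ⟨(J, {i ∈ J | x.1 i = true}), rfl⟩, fun y hy => subset_closure (hJ y ?_)⟩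
      intro i hi
      rw [hy i hi]
      simp [hi]
  calc piTheta D ≤ #(range V) := csInf_le' ⟨_, hV, rfl⟩
    _ ≤ #(Finset I × Finset I) := mk_range_le
    _ = #I := by
      rw [← mul_def, mk_finset_of_infinite,
        mul_eq_self (aleph0_le_mk I)]

lemma thetaDenseSetsMeetInfinitely_of_regularSpace {X : Type u} [TopologicalSpace X] [T1Space X]
    [RegularSpace X] (h : ∀ x : X, ¬ IsOpen ({x} : Set X)) : ThetaDenseSetsMeetInfinitely X := by
  intro D hD U hU hne hfin
  have (x : X) : (𝓝[≠] x).NeBot :=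
    neBot_iff.2 fun hx => h x ((isOpen_singleton_iff_punctured_nhds x).2 hx)
  obtain ⟨x, hxU, hxD, hx⟩ :=
    ((isThetaDense_iff_dense.1 hD).sdiff_finite hfin).inter_open_nonempty U hU hne
  exact hx ⟨subset_closure hxU, hxD⟩

lemma deltaTheta_eq_aleph0_of_countable {X : Type u} [TopologicalSpace X] [Countable X] :
    deltaTheta X = ℵ₀ := by
  have hmem : (ℵ₀ : Cardinal.{u}) ∈ {c : Cardinal.{u} | ℵ₀ ≤ c ∧
      ∀ D : Set X, IsThetaDense D → ∃ C ⊆ D, IsThetaDense C ∧ #C ≤ c} :=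
    ⟨le_rfl, fun D hD => ⟨D, subset_rfl, hD, le_aleph0_iff_set_countable.2 D.to_countable⟩⟩
  exact le_antisymm (csInf_le' hmem) (le_csInf ⟨_, hmem⟩ fun c hc => hc.1)

/-! ### The grid space, where the selection principle fails -/

variable {I : Type u} (φ : I → ℕ → ℕ) (z : ℕ → (ℕ → ℕ) → Bool)

/-- The `m`-th point of the `n`-th dense set: it vanishes at `i` only if `φ i n ≤ m`. -/
def gridPoint (n m : ℕ) : I → Bool := fun i => if m < φ i n then true else z m (φ i)

/-- The countable subspace of `2 ^ I` formed by the points `gridPoint φ z n m`. -/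
def gridSpace : Set (I → Bool) := range fun p : ℕ × ℕ => gridPoint φ z p.1 p.2

/-- The `n`-th dense subset of `gridSpace φ z`. -/
def gridRow (n : ℕ) : Set (gridSpace φ z) := {x | ∃ m, x.1 = gridPoint φ z n m}

instance : Countable (gridSpace φ z) := (countable_range _).to_subtype

variable {φ z}

/-- Columns beyond all `φ i n` with `i ∈ J` are unaffected by the truncation on `J`. -/
lemma exists_gridPoint_pattern (hφ : Function.Injective φ)
    (hz : ∀ (J : Finset (ℕ → ℕ)) (ε : (ℕ → ℕ) → Bool) (M : ℕ), ∃ m ≥ M, ∀ f ∈ J, z m f = ε f)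
    (n : ℕ) (J : Finset I) (ε : I → Bool) : ∃ m, ∀ i ∈ J, gridPoint φ z n m i = ε i := by
  classical
  obtain ⟨m, hm, h⟩ := hz (J.image φ) (Function.extend φ ε fun _ => true) (J.sup fun i => φ i n)
  refine ⟨m, fun i hi => ?_⟩
  have hi' : φ i n ≤ m := (Finset.le_sup (f := fun i => φ i n) hi).trans hm
  rw [gridPoint, if_neg hi'.not_gt, h _ (Finset.mem_image_of_mem φ hi), hφ.extend_apply]

lemma realizesPatterns_gridSpace (hφ : Function.Injective φ)
    (hz : ∀ (J : Finset (ℕ → ℕ)) (ε : (ℕ → ℕ) → Bool) (M : ℕ), ∃ m ≥ M, ∀ f ∈ J, z m f = ε f) :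
    RealizesPatterns (gridSpace φ z) := fun J ε => by
  obtain ⟨m, hm⟩ := exists_gridPoint_pattern hφ hz 0 J ε
  exact ⟨_, ⟨(0, m), rfl⟩, hm⟩

lemma isThetaDense_gridRow (hφ : Function.Injective φ)
    (hz : ∀ (J : Finset (ℕ → ℕ)) (ε : (ℕ → ℕ) → Bool) (M : ℕ), ∃ m ≥ M, ∀ f ∈ J, z m f = ε f)
    (n : ℕ) : IsThetaDense (gridRow φ z n) := by
  refine isThetaDense_of_closure_inter_nonempty ?_
  rintro _ hW ⟨x, hx⟩
  obtain ⟨U, hU, rfl⟩ := isOpen_induced_iff.1 hW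
  obtain ⟨J, hJ⟩ := exists_cylinder_subset hU hx
  obtain ⟨m, hm⟩ := exists_gridPoint_pattern hφ hz n J x.1
  exact ⟨⟨gridPoint φ z n m, (n, m), rfl⟩, subset_closure (hJ _ hm), m, rfl⟩

lemma not_sFin_gridSpace (hφ : Function.Injective φ) (hmono : ∀ i, Monotone (φ i))
    (hunb : ∀ g : ℕ → ℕ, ∃ i, ∃ᶠ n in atTop, g n < φ i n)
    (hz : ∀ (J : Finset (ℕ → ℕ)) (ε : (ℕ → ℕ) → Bool) (M : ℕ), ∃ m ≥ M, ∀ f ∈ J, z m f = ε f) :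
    ¬ SFin (thetaDenseSets (gridSpace φ z)) (groupablyThetaDenseSets (gridSpace φ z)) := by
  intro h
  obtain ⟨B, hB, -, -, P, hPfin, hPdisj, hPB, hP⟩ := h _ (isThetaDense_gridRow hφ hz)
  -- Rows may overlap, so each selected point is assigned one inning that selected it.
  have hrow (p : gridSpace φ z) : ∃ n, p ∈ ⋃ n, (B n : Set (gridSpace φ z)) → p ∈ B n := by
    by_cases hp : p ∈ ⋃ n, (B n : Set (gridSpace φ z))
    · obtain ⟨n, hn⟩ := mem_iUnion.1 hp
      exact ⟨n, fun _ => hn⟩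
    · exact ⟨0, fun h => absurd h hp⟩
  choose r hr using hrow
  have hrP {k : ℕ} {p : gridSpace φ z} (hp : p ∈ P k) : p ∈ B (r p) :=
    hr p (hPB ▸ mem_iUnion_of_mem k hp)
  have hcol (p : gridSpace φ z) (k : ℕ) : ∃ m, p ∈ P k → p.1 = gridPoint φ z (r p) m := by
    by_cases hp : p ∈ P k
    · obtain ⟨m, hm⟩ := hB _ (hrP hp)
      exact ⟨m, fun _ => hm⟩
    · exact ⟨0, fun h => absurd h hp⟩
  choose c hc using hcol
  have hbound (k : ℕ) : ∃ b, ∀ p ∈ P k, c p k ≤ b := by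
    obtain ⟨b, hb⟩ := ((hPfin k).image fun p => c p k).bddAbove
    exact ⟨b, fun p hp => hb (mem_image_of_mem _ hp)⟩
  choose b hb using hbound
  -- Innings before `N` select finitely many points, each in at most one group.
  have hfar (N : ℕ) : ∃ k ≥ N, ∀ p ∈ P k, N ≤ r p := by
    have hfin : (⋃ p ∈ ⋃ n ∈ Iio N, (B n : Set (gridSpace φ z)), {k | p ∈ P k}).Finite := by
      refine ((finite_Iio N).biUnion fun n _ => (B n).finite_toSet).biUnion fun p _ => ?_
      refine Set.Subsingleton.finite fun k hk l hl => ?_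
      by_contra hkl
      exact (disjoint_left.1 (hPdisj hkl)) hk hl
    obtain ⟨k, hkN, hk⟩ := (Set.Ici_infinite N).exists_notMem_finite hfin
    refine ⟨k, hkN, fun p hp => ?_⟩
    by_contra hlt
    exact hk (mem_biUnion (mem_biUnion (not_le.1 hlt) (hrP hp)) hp)
  choose k hkN hk using hfar
  obtain ⟨i, hi⟩ := hunb fun N => b (k N)
  let U : Set (gridSpace φ z) := {x | x.1 i = false}
  have hcont : Continuous fun x : gridSpace φ z => x.1 i :=
    (continuous_apply i).comp continuous_subtype_val
  have hUo : IsOpen U := (isOpen_discrete {false}).preimage hcont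
  have hUc : IsClosed U := (isClosed_discrete {false}).preimage hcont
  have hUne : U.Nonempty := by
    obtain ⟨y, hy, hyi⟩ := realizesPatterns_gridSpace hφ hz {i} fun _ => false
    exact ⟨⟨y, hy⟩, hyi i (Finset.mem_singleton_self i)⟩
  obtain ⟨K, hK⟩ := eventually_atTop.1 (hP U hUo hUne)
  obtain ⟨N, hN, hKN⟩ := (hi.and_eventually (eventually_ge_atTop K)).exists
  obtain ⟨p, hpU, hpP⟩ := hK (k N) (hKN.trans (hkN N))
  rw [hUc.closure_eq] at hpU
  -- Monotonicity carries the excess at `N` to the later row of `p`.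
  have hlt : c p (k N) < φ i (r p) :=
    ((hb _ p hpP).trans_lt hN).trans_le (hmono i (hk N p hpP))
  have hpi : p.1 i = true := by rw [hc p _ hpP, gridPoint, if_pos hlt]
  exact Bool.false_ne_true ((show p.1 i = false from hpU).symm.trans hpi)

end Example

end ThetaSelection

theorem mainTheorem3 (κ : Cardinal.{u}) (hκ : ℵ₀ ≤ κ) :
    List.TFAE [
      κ < Cardinal.lift.{u, 0} ThetaSelection.boundingNumber,
      ∀ (X : Type u) [TopologicalSpace X] [T1Space X],
        (∀ x : X, ¬ IsOpen ({x} : Set X)) →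
        ThetaSelection.ThetaDenseSetsMeetInfinitely X →
        ThetaSelection.deltaTheta X = ℵ₀ → ThetaSelection.piTheta X ≤ κ →
        ¬ ThetaSelection.OneWinsGFin (ThetaSelection.thetaDenseSets X)
            (ThetaSelection.groupablyThetaDenseSets X),
      ∀ (X : Type u) [TopologicalSpace X] [T1Space X],
        (∀ x : X, ¬ IsOpen ({x} : Set X)) →
        ThetaSelection.ThetaDenseSetsMeetInfinitely X →
        ThetaSelection.deltaTheta X = ℵ₀ → ThetaSelection.piTheta X ≤ κ →
        ThetaSelection.SFin (ThetaSelection.thetaDenseSets X)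
            (ThetaSelection.groupablyThetaDenseSets X)] := by
  tfae_have 1 → 2 := fun h X _ _ _ hinf hδ hπ =>
    ThetaSelection.not_oneWinsGFin_of_lt_boundingNumber h X hinf hδ hπ
  tfae_have 2 → 3 := fun h X _ _ hiso hinf hδ hπ =>
    ThetaSelection.sFin_of_not_oneWinsGFin (h X hiso hinf hδ hπ)
  tfae_have 3 → 1 := by
    intro h
    by_contra! hle
    obtain ⟨F, hmono, hcard, hunb⟩ := ThetaSelection.exists_unbounded_monotone_family
    obtain ⟨z, hz⟩ := ThetaSelection.exists_frequently_dense_seq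
    have : Infinite F := (ThetaSelection.infinite_of_unbounded hunb).to_subtype
    let φ : ULift.{u} F → ℕ → ℕ := fun i => i.down.1
    have hφ : Function.Injective φ := Subtype.val_injective.comp ULift.down_injective
    have hD := ThetaSelection.realizesPatterns_gridSpace hφ hz
    refine ThetaSelection.not_sFin_gridSpace hφ (fun i => hmono _ i.down.2) (fun g => ?_) hz
      (h (ThetaSelection.gridSpace φ z) hD.not_isOpen_singleton
        (ThetaSelection.thetaDenseSetsMeetInfinitely_of_regularSpace hD.not_isOpen_singleton)
        ThetaSelection.deltaTheta_eq_aleph0_of_countable (hD.piTheta_le.trans ?_))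
    · obtain ⟨f, hf, hgf⟩ := hunb g
      exact ⟨⟨f, hf⟩, hgf⟩
    · rw [mk_uLift]
      exact (Cardinal.lift_le.2 hcard).trans hle
  tfae_finish
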